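/- Let $\tau>0$, $d,m\in\mathbb N$, and let $W$ be an $m$-dimensional Brownian motion on a probability space $(\Omega,\mathcal F,\mathbb P)$. Let $|\cdot|$ denote the Euclidean norm on $\mathbb R^d$ and the norm $|A|=\sqrt{\operatorname{trace}(A^{T}A)}$ on $\mathbb R^{d\times m}$; let $C=C([-\tau,0];\mathbb R^d)$ carry the norm $\|X\|=\sup_{-\tau\le\theta\le0}|X(\theta)|$, and let $B(M)=\{X\in C:\|X\|\le M\}$. Let $f:\mathbb R^d\times\mathbb R^d\to\mathbb R^d$ and $g:\mathbb R^d\times\mathbb R^d\to\mathbb R^{d\times m}$ satisfy: (H1) for every $R>0$ there is $\ell_R>0$ with $|f(x,y)-f(\bar x,\bar y)|\vee|g(x,y)-g(\bar x,\bar y)|\le\ell_R(|x-\bar x|+|y-\bar y|)$ whenever $|x|\vee|\bar x|\vee|y|\vee|\bar y|\le R$; (H2) there are constants $\alpha\ge2$ and $a_1,a_2,a_3\ge0$ with $a_2>a_3$ and $\langle 2x,f(x,y)\rangle+|g(x,y)|^2\le a_1-a_2|x|^\alpha+a_3|y|^\alpha$ for all $x,y\in\mathbb R^d$. Let $\Phi:[1,\infty)\to[0,\infty)$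 be a strictly increasing continuous function with $\Phi(R)\to\infty$ as $R\to\infty$ and, for every $R\ge1$, $$\sup_{|x|\vee|\bar x|\vee|y|\vee|\bar y|\le R}\left(\frac{|f(x,y)-f(\bar x,\bar y)|}{|x-\bar x|+1\wedge|y-\bar y|}+\frac{|g(x,y)-g(\bar x,\bar y)|^2}{(|x-\bar x|+1\wedge|y-\bar y|)^2}\right)\le\Phi(R)$$ (with $0/0=0$). Put $K=1\vee\Phi(1)\vee|f(0,0)|\vee|g(0,0)|^2$, let $\nu\in(0,1/3]$, and for $\triangle\in(0,1)$ let $\Gamma^{\triangle}(x)=\big(|x|\wedge\Phi^{-1}(K\triangle^{-\nu})\big)\frac{x}{|x|}$, $\Gamma^\triangle(0)=0$. For a step size $\triangle\in(0,1)$ of the form $\triangle=\tau/N$ with $N$ a positive integer, put $t_k=k\triangle$ for $k\ge-N$. For $\xi\in C$ define the truncated Euler-Maruyama scheme by $\breve u(t_k)=\xi(t_k)$ for $-N\le k\le0$, $u(t_k)=\Gamma^\triangle(\breve u(t_k))$ for $k\ge-N$, and $$\breve u(t_{k+1})=u(t_k)+f(u(t_k),u(t_{k-N}))\triangle+g(u(t_k),u(t_{k-N}))\big(W(t_{k+1})-W(t_k)\big),\qquad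 k\ge0.$$ Let $y(t)=\Gamma^\triangle(\xi(t))$ for $t\in[-\tau,0]$ and $y(t)=\frac{t_{k+1}-t}{\triangle}u(t_k)+\frac{t-t_k}{\triangle}u(t_{k+1})$ for $t\in[t_k,t_{k+1}]$, $k\ge0$. The truncated EM segment process (TEMSP) is the $C$-valued process $Y^{\xi,\triangle}_{t_k}(\theta)=y(t_k+\theta)$, $\theta\in[-\tau,0]$, $k\ge0$. Let $\hat\triangle_1\in(0,1)$ satisfy $a_2-6K^2\hat\triangle_1^{1-2\nu}>a_3$. Then for all $M>0$ and $\varepsilon>0$ there is a $\Lambda^*>M$ such that $$\sup_{\triangle\in(0,\hat\triangle_1]}\ \sup_{k\ge0}\ \sup_{\xi\in B(M)}\mathbb P\big\{\|Y^{\xi,\triangle}_{t_k}\|>\Lambda^*\big\}<\varepsilon,$$ where the supremum over $\triangle$ runs over the step sizes $\triangle=\tau/N$, $N\in\{1,2,\dots\}$, in $(0,\hat\triangle_1]$. -/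

import Mathlib

open MeasureTheory ProbabilityTheory Filter
open scoped NNReal ENNReal Matrix.Norms.Frobenius

noncomputable section

/-- An `m`-dimensional standard Brownian motion on the probability space `(Ω, P)`. -/
structure IsBrownianMotion {m : ℕ} {Ω : Type*} [MeasurableSpace Ω]
    (W : ℝ≥0 → Ω → EuclideanSpace ℝ (Fin m)) (P : Measure Ω) : Prop where
  measurable : ∀ t, Measurable (W t)
  zero : ∀ᵐ ω ∂P, W 0 ω = 0
  indep_increments : HasIndepIncrements W P
  law_increments : ∀ s t : ℝ≥0, s ≤ t →
    HasLaw (fun ω => W t ω - W s ω)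
      (multivariateGaussian 0 (((t : ℝ) - (s : ℝ)) • (1 : Matrix (Fin m) (Fin m) ℝ))) P
  continuous_paths : ∀ᵐ ω ∂P, Continuous fun t => W t ω

section Coefficients

variable {d m : ℕ}
  (f : EuclideanSpace ℝ (Fin d) → EuclideanSpace ℝ (Fin d) → EuclideanSpace ℝ (Fin d))
  (g : EuclideanSpace ℝ (Fin d) → EuclideanSpace ℝ (Fin d) → Matrix (Fin d) (Fin m) ℝ)

/-- The local Lipschitz condition on the coefficients. Matrices carry the Frobenius norm
`|A| = √(trace (Aᵀ A))`. -/
def LocallyLipschitzCoeff : Prop :=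
  ∀ R : ℝ, 0 < R → ∃ l : ℝ, 0 < l ∧
    ∀ x x' y y' : EuclideanSpace ℝ (Fin d), ‖x‖ ≤ R → ‖x'‖ ≤ R → ‖y‖ ≤ R → ‖y'‖ ≤ R →
      max ‖f x y - f x' y'‖ ‖g x y - g x' y'‖ ≤ l * (‖x - x'‖ + ‖y - y'‖)

/-- The dissipativity (Khasminskii-type) condition with constants `α, a₁, a₂, a₃`. -/
structure Dissipative (α a₁ a₂ a₃ : ℝ) : Prop where
  two_le : 2 ≤ α
  nonneg₁ : 0 ≤ a₁
  nonneg₂ : 0 ≤ a₂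
  nonneg₃ : 0 ≤ a₃
  lt : a₃ < a₂
  bound : ∀ x y : EuclideanSpace ℝ (Fin d),
    inner ℝ ((2 : ℝ) • x) (f x y) + ‖g x y‖ ^ 2 ≤ a₁ - a₂ * ‖x‖ ^ α + a₃ * ‖y‖ ^ α

/-- `Φ : [1, ∞) → [0, ∞)` is strictly increasing, continuous, tends to `∞` and dominates the
difference quotients of `f` and the squared difference quotients of `g` on balls of radius `R`
(at `x = x'`, `y = y'` the quotients read `0`). -/
structure IsGrowthControl (Φ : Set.Ici (1 : ℝ) → ℝ≥0) : Prop where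
  strictMono : StrictMono Φ
  continuous : Continuous Φ
  tendsto : Tendsto Φ atTop atTop
  bound : ∀ (R : Set.Ici (1 : ℝ)) (x x' y y' : EuclideanSpace ℝ (Fin d)),
    ‖x‖ ≤ R → ‖x'‖ ≤ R → ‖y‖ ≤ R → ‖y'‖ ≤ R →
      ‖f x y - f x' y'‖ / (‖x - x'‖ + min 1 ‖y - y'‖)
        + ‖g x y - g x' y'‖ ^ 2 / (‖x - x'‖ + min 1 ‖y - y'‖) ^ 2 ≤ Φ R

variable (Φ : Set.Ici (1 : ℝ) → ℝ≥0)

/-- The constant `K = 1 ∨ Φ(1) ∨ |f(0,0)| ∨ |g(0,0)|²`. -/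
def truncConst : ℝ :=
  max (max (max 1 (Φ ⟨1, Set.self_mem_Ici⟩ : ℝ)) ‖f 0 0‖) (‖g 0 0‖ ^ 2)

/-- The truncation radius `Φ⁻¹(K Δ^{-ν})`. Under `IsGrowthControl`, for `Δ ∈ (0,1)` and `ν > 0`,
the argument lies in the range `[Φ(1), ∞)` of `Φ`. -/
def truncRadius (ν Δ : ℝ) : Set.Ici (1 : ℝ) :=
  Function.invFun Φ (Real.toNNReal (truncConst f g Φ * Δ ^ (-ν)))

/-- The truncation mapping `x ↦ (|x| ∧ Φ⁻¹(K Δ^{-ν})) x / |x|`, equal to `0` at `x = 0`. -/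
def truncMap (ν Δ : ℝ) (x : EuclideanSpace ℝ (Fin d)) : EuclideanSpace ℝ (Fin d) :=
  min ‖x‖ (truncRadius f g Φ ν Δ : ℝ) • (‖x‖⁻¹ • x)

theorem continuous_truncMap (ν Δ : ℝ) : Continuous (truncMap f g Φ ν Δ) := by
  have hr : (0 : ℝ) ≤ (truncRadius f g Φ ν Δ : ℝ) :=
    zero_le_one.trans (truncRadius f g Φ ν Δ).2
  rw [continuous_iff_continuousAt]
  intro x
  by_cases hx : x = 0
  · subst hx
    have h0 : truncMap f g Φ ν Δ 0 = 0 := by simp [truncMap]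
    rw [ContinuousAt, h0]
    refine squeeze_zero_norm (a := fun y => ‖y‖) (fun y => ?_) ?_
    · by_cases hy : y = 0
      · simp [hy, h0]
      · have : ‖y‖ ≠ 0 := norm_ne_zero_iff.2 hy
        rw [truncMap, norm_smul, norm_smul, norm_inv, norm_norm, inv_mul_cancel₀ this, mul_one,
          Real.norm_of_nonneg (le_min (norm_nonneg _) hr)]
        exact min_le_left _ _
    · simpa using (continuous_norm (E := EuclideanSpace ℝ (Fin d))).tendsto 0
  · have : ‖x‖ ≠ 0 := norm_ne_zero_iff.2 hx
    unfold truncMap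
    exact (continuousAt_id.norm.min continuousAt_const).smul
      ((continuousAt_id.norm.inv₀ this).smul continuousAt_id)

variable (ν : ℝ) {τ : ℝ} (hτ : 0 < τ) (N : ℕ+)

/-- The step size `Δ = τ / N`. -/
def stepSize (τ : ℝ) (N : ℕ+) : ℝ := τ / (N : ℕ)

theorem stepSize_pos {τ : ℝ} (hτ : 0 < τ) (N : ℕ+) : 0 < stepSize τ N :=
  div_pos hτ (Nat.cast_pos.2 N.pos)

/-- The continuous initial path `ξ` as a function of real time; it is only evaluated on
`[-τ, 0]` below. -/
def initPath (ξ : C(Set.Icc (-τ) 0, EuclideanSpace ℝ (Fin d))) : ℝ → EuclideanSpace ℝ (Fin d) :=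
  Set.IccExtend (neg_nonpos.2 hτ.le) ξ

/-- The increment `W(t_{k+1}) - W(t_k)` of the path `w` over the `k`-th step, `k ≥ 0`. -/
def pathIncrement (τ : ℝ) (N : ℕ+) (w : ℝ≥0 → EuclideanSpace ℝ (Fin m)) (k : ℤ) :
    EuclideanSpace ℝ (Fin m) :=
  w (Real.toNNReal (((k : ℝ) + 1) * stepSize τ N)) - w (Real.toNNReal ((k : ℝ) * stepSize τ N))

variable (ξ : C(Set.Icc (-τ) 0, EuclideanSpace ℝ (Fin d)))
  (w : ℝ≥0 → EuclideanSpace ℝ (Fin m))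

/-- The untruncated iterates `ŭ(t_k)`, `k ≥ -N`, of the truncated Euler-Maruyama scheme along the
driving path `w`: `ŭ(t_k) = ξ(t_k)` for `-N ≤ k ≤ 0`, and
`ŭ(t_{k+1}) = u(t_k) + f(u(t_k), u(t_{k-N})) Δ + g(u(t_k), u(t_{k-N})) (w(t_{k+1}) - w(t_k))`
for `k ≥ 0`, where `u = Γ ∘ ŭ`. Values at `k < -N` are never used. -/
def preEM (k : ℤ) : EuclideanSpace ℝ (Fin d) :=
  if _h : k ≤ 0 then initPath hτ ξ ((k : ℝ) * stepSize τ N)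
  else
    let u₀ := truncMap f g Φ ν (stepSize τ N) (preEM (k - 1))
    let u₁ := truncMap f g Φ ν (stepSize τ N) (preEM (k - 1 - (N : ℕ)))
    u₀ + stepSize τ N • f u₀ u₁ + Matrix.toEuclideanLin (g u₀ u₁) (pathIncrement τ N w (k - 1))
termination_by k.toNat
decreasing_by all_goals omega

/-- The truncated iterates `u(t_k) = Γ(ŭ(t_k))`. -/
def truncEM (k : ℤ) : EuclideanSpace ℝ (Fin d) :=
  truncMap f g Φ ν (stepSize τ N) (preEM f g Φ ν hτ N ξ w k)

theorem truncEM_of_nonpos {k : ℤ} (hk : k ≤ 0) :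
    truncEM f g Φ ν hτ N ξ w k
      = truncMap f g Φ ν (stepSize τ N) (initPath hτ ξ ((k : ℝ) * stepSize τ N)) := by
  rw [truncEM, preEM, dif_pos hk]

theorem truncEM_succ {k : ℤ} (hk : 0 ≤ k) :
    truncEM f g Φ ν hτ N ξ w (k + 1)
      = truncMap f g Φ ν (stepSize τ N)
        (truncEM f g Φ ν hτ N ξ w k
          + stepSize τ N • f (truncEM f g Φ ν hτ N ξ w k) (truncEM f g Φ ν hτ N ξ w (k - (N : ℕ)))
          + Matrix.toEuclideanLin
              (g (truncEM f g Φ ν hτ N ξ w k) (truncEM f g Φ ν hτ N ξ w (k - (N : ℕ))))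
              (pathIncrement τ N w k)) := by
  rw [truncEM, preEM, dif_neg (by omega)]
  simp only [add_sub_cancel_right]
  rfl

/-- The continuous process `y`: `y(t) = Γ(ξ(t))` on `[-τ, 0]`, and the piecewise linear
interpolation of the `u(t_k)` on `[0, ∞)`. -/
def interpEM (t : ℝ) : EuclideanSpace ℝ (Fin d) :=
  if t ≤ 0 then truncMap f g Φ ν (stepSize τ N) (initPath hτ ξ t)
  else
    let k : ℤ := ⌊t / stepSize τ N⌋
    ((((k : ℝ) + 1) * stepSize τ N - t) / stepSize τ N) • truncEM f g Φ ν hτ N ξ w k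
      + ((t - (k : ℝ) * stepSize τ N) / stepSize τ N) • truncEM f g Φ ν hτ N ξ w (k + 1)

theorem interpEM_of_mem_Icc {k : ℕ} {t : ℝ}
    (ht : t ∈ Set.Icc ((k : ℝ) * stepSize τ N) (((k : ℝ) + 1) * stepSize τ N)) :
    interpEM f g Φ ν hτ N ξ w t
      = ((((k : ℝ) + 1) * stepSize τ N - t) / stepSize τ N) • truncEM f g Φ ν hτ N ξ w k
        + ((t - (k : ℝ) * stepSize τ N) / stepSize τ N) • truncEM f g Φ ν hτ N ξ w (k + 1) := by
  have hΔ := stepSize_pos hτ N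
  rcases ht with ⟨h1, h2⟩
  by_cases h0 : t ≤ 0
  · have hk : (k : ℝ) = 0 := by
      by_contra hk
      have : 0 < (k : ℝ) := lt_of_le_of_ne (Nat.cast_nonneg k) (Ne.symm hk)
      have := mul_pos this hΔ
      linarith
    have hk' : k = 0 := by exact_mod_cast hk
    subst hk'
    have ht : t = 0 := le_antisymm h0 (by simpa using h1)
    subst ht
    have : truncEM f g Φ ν hτ N ξ w ((0 : ℕ) : ℤ)
        = truncMap f g Φ ν (stepSize τ N) (initPath hτ ξ 0) := by
      rw [truncEM_of_nonpos f g Φ ν hτ N ξ w (by simp)]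
      simp
    rw [this, interpEM, if_pos le_rfl]
    simp [hΔ.ne']
  · rw [interpEM, if_neg h0]
    rcases h2.lt_or_eq with h2 | h2
    · have : ⌊t / stepSize τ N⌋ = (k : ℤ) := by
        rw [Int.floor_eq_iff]
        constructor
        · rw [le_div_iff₀ hΔ]
          exact_mod_cast h1
        · rw [div_lt_iff₀ hΔ]
          exact_mod_cast h2
      rw [this]
      simp
    · have : ⌊t / stepSize τ N⌋ = (k : ℤ) + 1 := by
        rw [h2, mul_div_cancel_right₀ _ hΔ.ne']
        exact_mod_cast Int.floor_natCast (R := ℝ) (k + 1)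
      rw [this, h2]
      have e1 : ((k : ℝ) + 1 + 1) * stepSize τ N - ((k : ℝ) + 1) * stepSize τ N
          = stepSize τ N := by ring
      have e2 : ((k : ℝ) + 1) * stepSize τ N - (k : ℝ) * stepSize τ N = stepSize τ N := by ring
      simp [e1, e2, hΔ.ne']

theorem continuous_interpEM : Continuous (interpEM f g Φ ν hτ N ξ w) := by
  have hΔ := stepSize_pos hτ N
  have key : ∀ k : ℕ, ContinuousOn (interpEM f g Φ ν hτ N ξ w)
      (Set.Iic ((k : ℝ) * stepSize τ N)) := by
    intro k
    induction k with
    | zero =>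
      have : ContinuousOn (fun t => truncMap f g Φ ν (stepSize τ N) (initPath hτ ξ t))
          (Set.Iic (((0 : ℕ) : ℝ) * stepSize τ N)) :=
        ((continuous_truncMap f g Φ ν _).comp ξ.continuous.Icc_extend').continuousOn
      refine this.congr fun t ht => ?_
      have ht : t ≤ 0 := by simpa using ht
      rw [interpEM, if_pos ht]
    | succ k ih =>
      have h : Set.Iic (((k + 1 : ℕ) : ℝ) * stepSize τ N)
          = Set.Iic ((k : ℝ) * stepSize τ N)
            ∪ Set.Icc ((k : ℝ) * stepSize τ N) (((k : ℝ) + 1) * stepSize τ N) := by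
        rw [Set.Iic_union_Icc_eq_Iic (by nlinarith)]
        push_cast
        rfl
      rw [h]
      refine ih.union_of_isClosed ?_ isClosed_Iic isClosed_Icc
      refine ContinuousOn.congr ?_ fun t ht => interpEM_of_mem_Icc f g Φ ν hτ N ξ w ht
      fun_prop
  rw [continuous_iff_continuousAt]
  intro t
  obtain ⟨k, hk⟩ := exists_nat_gt (t / stepSize τ N)
  exact (key k).continuousAt (Iic_mem_nhds ((div_lt_iff₀ hΔ).1 hk))

/-- The truncated Euler-Maruyama segment process `Y_{t_k}(θ) = y(t_k + θ)`, `θ ∈ [-τ, 0]`, as an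
element of `C([-τ, 0]; ℝ^d)` with the supremum norm. -/
def temsp (k : ℕ) : C(Set.Icc (-τ) 0, EuclideanSpace ℝ (Fin d)) where
  toFun θ := interpEM f g Φ ν hτ N ξ w ((k : ℝ) * stepSize τ N + θ)
  continuous_toFun := (continuous_interpEM f g Φ ν hτ N ξ w).comp (by fun_prop)

end Coefficients

end

/-! ### Truncation and the one-step estimate. -/

section Deterministic

variable {d m : ℕ}
  {f : EuclideanSpace ℝ (Fin d) → EuclideanSpace ℝ (Fin d) → EuclideanSpace ℝ (Fin d)}
  {g : EuclideanSpace ℝ (Fin d) → EuclideanSpace ℝ (Fin d) → Matrix (Fin d) (Fin m) ℝ}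
  {Φ : Set.Ici (1 : ℝ) → ℝ≥0}

/-! The argument is a second moment bound uniform in time, upgraded to a bound on a whole delay
window by a maximal inequality.

On the truncation ball `Δ|f|²` is at most `q (1 + |x|²)` with `q = 6K²Δ₁^{1-2ν}`. One step therefore
has conditional second moment at most `|x|² + Δ(C - b|x|^α + a|y|^α)`, where `C = a₁ + 2q`, `b = a₂
- q` and `a = a₃ < b` (`Dissipative.step_le`). The delayed term is absorbed by adding to `|u(t_k)|²`
a sum of past `α`-th powers whose weights fall linearly from some `c ∈ (a, b)` towards `a` across
the delay (`lyapunov`). The gap `b - c` and the slope of the weights leave enough negativity for `E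
V_{k+1} ≤ (1 - κΔ) E V_k + Δ(C + κ)` with `κ` free of `Δ` (`lintegral_lyapunov_succ_le`), so `E V_k`
is bounded uniformly in `Δ`, `k` and `ξ ∈ B(M)`.

The segment norm is controlled by `ξ` and the iterates over at most `N + 1` preceding steps. Per
step `V` grows in mean by at most `Δ(C + κ)`, also on events of the past, so
`mul_measure_exists_lt_le` costs at most `(N + 1)Δ(C + κ) ≤ 2τ(C + κ)`. This bounds `r² P(‖Y‖ > r)`
by a constant, and a large `r` concludes. -/

theorem norm_truncMap (ν Δ : ℝ) (x : EuclideanSpace ℝ (Fin d)) :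
    ‖truncMap f g Φ ν Δ x‖ = min ‖x‖ (truncRadius f g Φ ν Δ : ℝ) := by
  have hr : (0 : ℝ) ≤ (truncRadius f g Φ ν Δ : ℝ) :=
    zero_le_one.trans (truncRadius f g Φ ν Δ).2
  by_cases hx : x = 0
  · simp [hx, truncMap, hr]
  · have : ‖x‖ ≠ 0 := norm_ne_zero_iff.2 hx
    rw [truncMap, norm_smul, norm_smul, norm_inv, norm_norm, inv_mul_cancel₀ this, mul_one,
      Real.norm_of_nonneg (le_min (norm_nonneg _) hr)]

theorem norm_truncMap_le (ν Δ : ℝ) (x : EuclideanSpace ℝ (Fin d)) :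
    ‖truncMap f g Φ ν Δ x‖ ≤ ‖x‖ := by
  rw [norm_truncMap]; exact min_le_left _ _

theorem norm_truncMap_le_truncRadius (ν Δ : ℝ) (x : EuclideanSpace ℝ (Fin d)) :
    ‖truncMap f g Φ ν Δ x‖ ≤ truncRadius f g Φ ν Δ := by
  rw [norm_truncMap]; exact min_le_right _ _

theorem one_le_truncConst : 1 ≤ truncConst f g Φ := by
  simp [truncConst]

theorem norm_le_truncConst : ‖f 0 0‖ ≤ truncConst f g Φ := by
  simp [truncConst]

/-- Since `K ≥ Φ(1)` and `Δ^{-ν} ≥ 1`, the intermediate value theorem puts the argument in the range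
of `Φ`, so `invFun` does not return its default value. -/
theorem IsGrowthControl.apply_truncRadius (hΦ : IsGrowthControl f g Φ) {ν Δ : ℝ} (hν : 0 ≤ ν)
    (hΔ : 0 < Δ) (hΔ' : Δ ≤ 1) :
    (Φ (truncRadius f g Φ ν Δ) : ℝ) = truncConst f g Φ * Δ ^ (-ν) := by
  have hK : (1 : ℝ) ≤ truncConst f g Φ := one_le_truncConst
  have hp : 1 ≤ Δ ^ (-ν) := Real.one_le_rpow_of_pos_of_le_one_of_nonpos hΔ hΔ' (by linarith)
  have hpos : 0 ≤ truncConst f g Φ * Δ ^ (-ν) := by positivity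
  have hmem : Real.toNNReal (truncConst f g Φ * Δ ^ (-ν)) ∈ Set.range Φ := by
    have : PreconnectedSpace (Set.Ici (1 : ℝ)) := Subtype.preconnectedSpace isPreconnected_Ici
    refine mem_range_of_exists_le_of_exists_ge hΦ.continuous ⟨⟨1, Set.self_mem_Ici⟩, ?_⟩ ?_
    · refine NNReal.coe_le_coe.1 ?_
      rw [Real.coe_toNNReal _ hpos]
      have : (Φ ⟨1, Set.self_mem_Ici⟩ : ℝ) ≤ truncConst f g Φ := by simp [truncConst]
      nlinarith
    · exact (hΦ.tendsto.eventually_ge_atTop _).exists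
  rw [truncRadius, Function.invFun_eq hmem, Real.coe_toNNReal _ hpos]

/-- The cap `1 ∧ |y|` in the growth control removes `y` from the bound, so the `|f|²` error will
lower only `a₂` and leave `a₃` intact. -/
theorem IsGrowthControl.norm_sq_le (hΦ : IsGrowthControl f g Φ) {ν Δ : ℝ} (hν : 0 ≤ ν)
    (hΔ : 0 < Δ) (hΔ' : Δ ≤ 1) {x y : EuclideanSpace ℝ (Fin d)}
    (hx : ‖x‖ ≤ truncRadius f g Φ ν Δ) (hy : ‖y‖ ≤ truncRadius f g Φ ν Δ) :
    ‖f x y‖ ^ 2 ≤ 6 * truncConst f g Φ ^ 2 * Δ ^ (-(2 * ν)) * (1 + ‖x‖ ^ 2) := by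
  set K := truncConst f g Φ
  have hK : (1 : ℝ) ≤ K := one_le_truncConst
  have hp : 1 ≤ Δ ^ (-ν) := Real.one_le_rpow_of_pos_of_le_one_of_nonpos hΔ hΔ' (by linarith)
  have hr : (0 : ℝ) ≤ (truncRadius f g Φ ν Δ : ℝ) :=
    zero_le_one.trans (truncRadius f g Φ ν Δ).2
  have hb := hΦ.bound (truncRadius f g Φ ν Δ) x 0 y 0 hx (by simpa using hr) hy (by simpa using hr)
  rw [hΦ.apply_truncRadius hν hΔ hΔ', sub_zero, sub_zero] at hb
  have hm : 0 ≤ min 1 ‖y‖ := le_min zero_le_one (norm_nonneg _)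
  have hm1 : min 1 ‖y‖ ≤ 1 := min_le_left _ _
  have hd : ‖f x y - f 0 0‖ ≤ K * Δ ^ (-ν) * (‖x‖ + 1) := by
    -- With a zero denominator the quotient bound says nothing, but then `x = y = 0`.
    rcases (add_nonneg (norm_nonneg x) hm).eq_or_lt with h0 | h0
    · have hx0 : x = 0 := norm_eq_zero.1 (by linarith [norm_nonneg x])
      have hy0 : y = 0 := by
        by_contra hne
        have : 0 < min 1 ‖y‖ := lt_min one_pos (norm_pos_iff.2 hne)
        linarith [norm_nonneg x]
      subst hx0 hy0
      simp only [sub_self, norm_zero]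
      positivity
    · have h1 : ‖f x y - f 0 0‖ / (‖x‖ + min 1 ‖y‖) ≤ K * Δ ^ (-ν) :=
        (le_add_of_nonneg_right (by positivity)).trans hb
      rw [div_le_iff₀ h0] at h1
      refine h1.trans ?_
      gcongr
  have h0 : ‖f 0 0‖ ≤ K := norm_le_truncConst
  have h1 : ‖f x y‖ ≤ K * Δ ^ (-ν) * (2 + ‖x‖) := by
    have := norm_le_norm_add_norm_sub' (f x y) (f 0 0)
    nlinarith
  have h2 : Δ ^ (-(2 * ν)) = (Δ ^ (-ν)) ^ 2 := by
    rw [← Real.rpow_natCast, ← Real.rpow_mul hΔ.le]; congr 1; push_cast; ring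
  calc ‖f x y‖ ^ 2 ≤ (K * Δ ^ (-ν) * (2 + ‖x‖)) ^ 2 := by gcongr
    _ = K ^ 2 * (Δ ^ (-ν)) ^ 2 * (2 + ‖x‖) ^ 2 := by ring
    _ ≤ K ^ 2 * (Δ ^ (-ν)) ^ 2 * (6 * (1 + ‖x‖ ^ 2)) := by
        gcongr
        nlinarith [sq_nonneg (‖x‖ - 1)]
    _ = _ := by rw [h2]; ring

theorem sq_le_one_add_rpow {x α : ℝ} (hx : 0 ≤ x) (hα : 2 ≤ α) : x ^ 2 ≤ 1 + x ^ α := by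
  rcases le_total x 1 with h | h
  · have : x ^ 2 ≤ 1 := pow_le_one₀ hx h
    linarith [Real.rpow_nonneg hx α]
  · have := Real.rpow_le_rpow_of_exponent_le h hα
    rw [Real.rpow_two] at this
    linarith

/-- The one-step second moment bound of the scheme inside the truncation ball. -/
theorem Dissipative.step_le {α a₁ a₂ a₃ : ℝ} (hH : Dissipative f g α a₁ a₂ a₃)
    (hΦ : IsGrowthControl f g Φ) {ν Δ Δ₁ : ℝ} (hν : 0 ≤ ν) (hν' : 2 * ν ≤ 1)
    (hΔ : 0 < Δ) (hΔΔ₁ : Δ ≤ Δ₁) (hΔ₁ : Δ₁ ≤ 1) {x y : EuclideanSpace ℝ (Fin d)}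
    (hx : ‖x‖ ≤ truncRadius f g Φ ν Δ) (hy : ‖y‖ ≤ truncRadius f g Φ ν Δ) :
    ‖x + Δ • f x y‖ ^ 2 + Δ * ‖g x y‖ ^ 2 ≤
      ‖x‖ ^ 2 + Δ * ((a₁ + 2 * (6 * truncConst f g Φ ^ 2 * Δ₁ ^ (1 - 2 * ν)))
        - (a₂ - 6 * truncConst f g Φ ^ 2 * Δ₁ ^ (1 - 2 * ν)) * ‖x‖ ^ α + a₃ * ‖y‖ ^ α) := by
  have hf := hΦ.norm_sq_le hν hΔ (hΔΔ₁.trans hΔ₁) hx hy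
  have hb := hH.bound x y
  set K := truncConst f g Φ
  have h1 : Δ ^ (1 - 2 * ν) ≤ Δ₁ ^ (1 - 2 * ν) :=
    Real.rpow_le_rpow hΔ.le hΔΔ₁ (by linarith)
  have h2 : Δ * Δ ^ (-(2 * ν)) = Δ ^ (1 - 2 * ν) := by
    rw [sub_eq_add_neg, Real.rpow_add hΔ, Real.rpow_one]
  -- Here `2ν ≤ 1` makes the power of `Δ` monotone, and `|x|² ≤ 1 + |x|^α` lets the dissipation
  -- absorb the error.
  have h3 : Δ * ‖f x y‖ ^ 2 ≤ 6 * K ^ 2 * Δ₁ ^ (1 - 2 * ν) * (2 + ‖x‖ ^ α) :=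
    calc Δ * ‖f x y‖ ^ 2 ≤ Δ * (6 * K ^ 2 * Δ ^ (-(2 * ν)) * (1 + ‖x‖ ^ 2)) := by gcongr
      _ = 6 * K ^ 2 * Δ ^ (1 - 2 * ν) * (1 + ‖x‖ ^ 2) := by rw [← h2]; ring
      _ ≤ 6 * K ^ 2 * Δ₁ ^ (1 - 2 * ν) * (1 + ‖x‖ ^ 2) := by gcongr
      _ ≤ _ := by
        have : 0 ≤ Δ₁ ^ (1 - 2 * ν) := Real.rpow_nonneg (hΔ.le.trans hΔΔ₁) _
        gcongr _ * ?_
        linarith [sq_le_one_add_rpow (norm_nonneg x) hH.two_le]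
  rw [real_inner_smul_left] at hb
  have h4 : ‖x + Δ • f x y‖ ^ 2
      = ‖x‖ ^ 2 + Δ * (2 * inner ℝ x (f x y)) + Δ * (Δ * ‖f x y‖ ^ 2) := by
    rw [norm_add_sq_real, real_inner_smul_right, norm_smul, Real.norm_of_nonneg hΔ.le]
    ring
  rw [h4]
  have := mul_le_mul_of_nonneg_left (add_le_add hb h3) hΔ.le
  linarith

end Deterministic

/-! ### The delayed Lyapunov functional and its contraction. -/

section Lyapunov

variable {E : Type*} [NormedAddCommGroup E]

/-- The delayed part of the Lyapunov functional: the past `α`-th powers with weights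
decreasing linearly from `c` to `a`. -/
noncomputable def delaySum (α c a : ℝ) (N : ℕ) (x : ℤ → E) (k : ℤ) : ℝ :=
  ∑ i ∈ Finset.range N, (c - (c - a) / N * i) * ‖x (k - 1 - i)‖ ^ α

/-- The discrete Lyapunov functional with delay. -/
noncomputable def lyapunov (α c a Δ : ℝ) (N : ℕ) (x : ℤ → E) (k : ℤ) : ℝ :=
  ‖x k‖ ^ 2 + Δ * delaySum α c a N x k

theorem delaySum_weight_nonneg {c a : ℝ} {N i : ℕ} (ha : 0 ≤ a) (hac : a ≤ c) (hi : i < N) :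
    0 ≤ c - (c - a) / N * i := by
  have hN : (0 : ℝ) < N := by exact_mod_cast (Nat.zero_le i).trans_lt hi
  have : (i : ℝ) / N ≤ 1 := (div_le_one hN).2 (by exact_mod_cast hi.le)
  have : (c - a) / N * i = (c - a) * (i / N) := by ring
  nlinarith

theorem delaySum_nonneg {α c a : ℝ} {N : ℕ} (ha : 0 ≤ a) (hac : a ≤ c) (x : ℤ → E) (k : ℤ) :
    0 ≤ delaySum α c a N x k :=
  Finset.sum_nonneg fun _ hi =>
    mul_nonneg (delaySum_weight_nonneg ha hac (Finset.mem_range.1 hi))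
      (Real.rpow_nonneg (norm_nonneg _) _)

theorem delaySum_le {α c a : ℝ} {N : ℕ} (hac : a ≤ c) (x : ℤ → E) (k : ℤ) :
    delaySum α c a N x k ≤ c * ∑ i ∈ Finset.range N, ‖x (k - 1 - i)‖ ^ α := by
  rw [delaySum, Finset.mul_sum]
  refine Finset.sum_le_sum fun i _ => ?_
  have : 0 ≤ (c - a) / N * i := mul_nonneg (div_nonneg (by linarith) (by positivity)) (by positivity)
  exact mul_le_mul_of_nonneg_right (by linarith) (Real.rpow_nonneg (norm_nonneg _) _)

/-- The linear weight at `i = N` is exactly `a`, so the extra term completes the sum to `N + 1`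
terms. The term `i = 0` carries `c`, and every other weight has dropped by `(c - a) / N`. -/
theorem delaySum_succ {α c a : ℝ} {N : ℕ} (hN : N ≠ 0) (x : ℤ → E) (k : ℤ) :
    delaySum α c a N x (k + 1) + a * ‖x (k - N)‖ ^ α
      = c * ‖x k‖ ^ α + delaySum α c a N x k
        - (c - a) / N * ∑ i ∈ Finset.range N, ‖x (k - 1 - i)‖ ^ α := by
  have hN' : (N : ℝ) ≠ 0 := by exact_mod_cast hN
  have h1 : delaySum α c a N x (k + 1) + a * ‖x (k - N)‖ ^ α
      = ∑ i ∈ Finset.range (N + 1), (c - (c - a) / N * i) * ‖x (k - i)‖ ^ α := by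
    rw [Finset.sum_range_succ, div_mul_cancel₀ _ hN', delaySum]
    simp
  rw [h1, Finset.sum_range_succ', delaySum, Finset.mul_sum]
  have h2 : ∀ i : ℕ, k - ((i + 1 : ℕ) : ℤ) = k - 1 - i := fun i => by push_cast; ring
  simp only [h2, Nat.cast_zero, mul_zero, sub_zero]
  rw [add_comm, add_sub_assoc, ← Finset.sum_sub_distrib]
  congr 1
  refine Finset.sum_congr rfl fun i _ => ?_
  push_cast
  ring

theorem lyapunov_nonneg {α c a Δ : ℝ} {N : ℕ} (ha : 0 ≤ a) (hac : a ≤ c) (hΔ : 0 ≤ Δ)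
    (x : ℤ → E) (k : ℤ) : 0 ≤ lyapunov α c a Δ N x k :=
  add_nonneg (sq_nonneg _) (mul_nonneg hΔ (delaySum_nonneg ha hac x k))

theorem sq_le_lyapunov {α c a Δ : ℝ} {N : ℕ} (ha : 0 ≤ a) (hac : a ≤ c) (hΔ : 0 ≤ Δ)
    (x : ℤ → E) (k : ℤ) : ‖x k‖ ^ 2 ≤ lyapunov α c a Δ N x k :=
  le_add_of_nonneg_right (mul_nonneg hΔ (delaySum_nonneg ha hac x k))

theorem lyapunov_le {α c a Δ M : ℝ} {N : ℕ} (hα : 0 ≤ α) (hc : 0 ≤ c) (hac : a ≤ c) (hΔ : 0 ≤ Δ)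
    {x : ℤ → E} {k : ℤ} (hx : ∀ j ≤ k, ‖x j‖ ≤ M) :
    lyapunov α c a Δ N x k ≤ M ^ 2 + Δ * N * c * M ^ α := by
  have h1 : ∑ i ∈ Finset.range N, ‖x (k - 1 - i)‖ ^ α ≤ N * M ^ α := by
    have := Finset.sum_le_card_nsmul (Finset.range N) (fun i : ℕ => ‖x (k - 1 - i)‖ ^ α) (M ^ α)
      fun i _ => Real.rpow_le_rpow (norm_nonneg _) (hx _ (by omega)) hα
    simpa using this
  have h2 := (delaySum_le (α := α) (N := N) hac x k).trans (mul_le_mul_of_nonneg_left h1 hc)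
  have h3 : ‖x k‖ ^ 2 ≤ M ^ 2 := by gcongr; exact hx k le_rfl
  have := mul_le_mul_of_nonneg_left h2 hΔ
  rw [lyapunov]
  nlinarith

/-- Shifting the sum cancels the delayed term and spends `c` of the dissipation `b`. The surplus `b
- c` contracts the square and the drop in weights contracts the delay sum. Here `p` plays the
conditional second moment of the next iterate. -/
theorem add_delaySum_succ_le {α c a b C Δ τ κ p : ℝ} {N : ℕ} (hα : 2 ≤ α) (ha : 0 ≤ a)
    (hac : a < c) (hN : N ≠ 0) (hΔ : 0 ≤ Δ) (hτ : 0 < τ) (hΔN : Δ * N = τ)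
    (hκ0 : 0 ≤ κ) (hκ1 : κ ≤ b - c) (hκ2 : κ ≤ (c - a) / (τ * c)) {x : ℤ → E} {k : ℤ}
    (hp : p ≤ ‖x k‖ ^ 2 + Δ * (C - b * ‖x k‖ ^ α + a * ‖x (k - N)‖ ^ α)) :
    p + Δ * delaySum α c a N x (k + 1) ≤ (1 - κ * Δ) * lyapunov α c a Δ N x k + Δ * (C + κ) := by
  have hc : 0 < c := ha.trans_lt hac
  have hN' : (0 : ℝ) < N := by exact_mod_cast Nat.pos_of_ne_zero hN
  have hs := delaySum_succ (α := α) (c := c) (a := a) hN x k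
  have hT := delaySum_le (α := α) (N := N) hac.le x k
  set T := ∑ i ∈ Finset.range N, ‖x (k - 1 - i)‖ ^ α
  set S := delaySum α c a N x k with hS
  have hS0 : 0 ≤ S := delaySum_nonneg ha hac.le x k
  -- From `S ≤ cT` and `ΔN = τ`; this is why `κ ≤ (c - a) / (τc)` suffices for every step size.
  have hT' : κ * (Δ * S) ≤ (c - a) / N * T := by
    have h1 : (c - a) / (τ * c) * (Δ * S) ≤ (c - a) / N * T := by
      rw [← hΔN]
      rcases hΔ.eq_or_lt with h | h
      · rw [← h] at hΔN; simp at hΔN; linarith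
      · have : (c - a) / (Δ * N * c) * (Δ * S) = (c - a) / N * (S / c) := by
          field_simp
        rw [this]
        have : S / c ≤ T := by rw [div_le_iff₀ hc]; linarith
        have : 0 ≤ (c - a) / N := div_nonneg (by linarith) hN'.le
        gcongr
    exact (mul_le_mul_of_nonneg_right hκ2 (by positivity)).trans h1
  have hX : κ * (‖x k‖ ^ 2 - 1) ≤ (b - c) * ‖x k‖ ^ α := by
    have h0 : 0 ≤ ‖x k‖ ^ α := Real.rpow_nonneg (norm_nonneg _) _
    have := sq_le_one_add_rpow (norm_nonneg (x k)) hα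
    nlinarith
  have h1 : delaySum α c a N x (k + 1)
      = c * ‖x k‖ ^ α + S - (c - a) / N * T - a * ‖x (k - N)‖ ^ α := by linarith
  rw [h1, lyapunov, ← hS]
  have := mul_le_mul_of_nonneg_left (add_le_add hT' hX) hΔ
  nlinarith

end Lyapunov

/-! ### Second moments of Gaussian increments. -/

section Gaussian

variable {d m : ℕ}

theorem Matrix.frobenius_norm_sq_eq_sum (A : Matrix (Fin d) (Fin m) ℝ) :
    ‖A‖ ^ 2 = ∑ i, ∑ j, A i j ^ 2 := by
  rw [Matrix.frobenius_norm_def, ← Real.sqrt_eq_rpow, Real.sq_sqrt]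
  · simp
  · positivity

theorem posSemidef_smul_one {r : ℝ} (hr : 0 ≤ r) :
    (r • (1 : Matrix (Fin m) (Fin m) ℝ)).PosSemidef :=
  Matrix.PosSemidef.one.smul hr

theorem integral_sq_add_inner_multivariateGaussian {r : ℝ} (hr : 0 ≤ r) (b : ℝ)
    (x : EuclideanSpace ℝ (Fin m)) :
    ∫ z, (b + inner ℝ x z) ^ 2 ∂(multivariateGaussian 0 (r • (1 : Matrix (Fin m) (Fin m) ℝ)))
      = b ^ 2 + r * ‖x‖ ^ 2 := by
  set μ := multivariateGaussian 0 (r • (1 : Matrix (Fin m) (Fin m) ℝ)) with hμ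
  have hid : MemLp id 2 μ := IsGaussian.memLp_two_id
  have hL : MemLp (fun z => inner ℝ x z) 2 μ := hid.const_inner x
  have hint : Integrable (fun z => inner ℝ x z) μ := hL.integrable (by norm_num)
  have h0 : ∫ z, inner ℝ x z ∂μ = 0 := by
    rw [integral_inner (f := fun z => z) (hid.integrable (by norm_num)) x, hμ,
      integral_id_multivariateGaussian, inner_zero_right]
  have h1 : ∫ z, (inner ℝ x z) ^ 2 ∂μ = r * ‖x‖ ^ 2 := by
    have hv := covarianceBilin_self hid x
    rw [covarianceBilin_multivariateGaussian (posSemidef_smul_one hr),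
      variance_eq_sub hL, h0] at hv
    simp only [Pi.pow_apply, ne_eq, OfNat.ofNat_ne_zero, not_false_eq_true, zero_pow,
      sub_zero] at hv
    rw [← hv, Matrix.smul_mulVec, Matrix.one_mulVec, dotProduct_smul, smul_eq_mul,
      EuclideanSpace.real_norm_sq_eq]
    simp [dotProduct, sq]
  have h2 : ∀ z, (b + inner ℝ x z) ^ 2 = b ^ 2 + 2 * b * inner ℝ x z + (inner ℝ x z) ^ 2 :=
    fun z => by ring
  have h3 : Integrable (fun z => b ^ 2 + 2 * b * inner ℝ x z) μ :=
    (integrable_const _).add (hint.const_mul _)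
  simp only [h2]
  rw [integral_add h3 hL.integrable_sq,
    integral_add (integrable_const _) (hint.const_mul _), integral_const_mul, h0, h1]
  simp

theorem integrable_sq_add_inner_multivariateGaussian (r b : ℝ) (x : EuclideanSpace ℝ (Fin m)) :
    Integrable (fun z => (b + inner ℝ x z) ^ 2)
      (multivariateGaussian 0 (r • (1 : Matrix (Fin m) (Fin m) ℝ))) :=
  ((memLp_const b).add (IsGaussian.memLp_two_id.const_inner x)).integrable_sq

/-- Each coordinate is `b i` plus the inner product with a row of `A`; the squared row norms add up
to the Frobenius norm. -/
theorem lintegral_norm_sq_add_multivariateGaussian {r s : ℝ} (hr : 0 ≤ r) (hs : 0 ≤ s)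
    (b : EuclideanSpace ℝ (Fin d)) (A : Matrix (Fin d) (Fin m) ℝ) :
    ∫⁻ z, ENNReal.ofReal (‖b + Matrix.toEuclideanLin A z‖ ^ 2 + s)
        ∂(multivariateGaussian 0 (r • (1 : Matrix (Fin m) (Fin m) ℝ)))
      = ENNReal.ofReal (‖b‖ ^ 2 + r * ‖A‖ ^ 2 + s) := by
  set μ := multivariateGaussian 0 (r • (1 : Matrix (Fin m) (Fin m) ℝ))
  have h1 : ∀ z, ‖b + Matrix.toEuclideanLin A z‖ ^ 2
      = ∑ i, (b i + inner ℝ (WithLp.toLp 2 (A i) : EuclideanSpace ℝ (Fin m)) z) ^ 2 := by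
    intro z
    rw [EuclideanSpace.real_norm_sq_eq]
    refine Finset.sum_congr rfl fun i _ => ?_
    simp [PiLp.inner_apply, Matrix.mulVec, dotProduct, mul_comm, Matrix.toLpLin_apply]
  have hI : Integrable (fun z => ‖b + Matrix.toEuclideanLin A z‖ ^ 2) μ := by
    simp only [h1]
    exact integrable_finsetSum _ fun i _ => integrable_sq_add_inner_multivariateGaussian r _ _
  have hIs : Integrable (fun z => ‖b + Matrix.toEuclideanLin A z‖ ^ 2 + s) μ :=
    hI.add (integrable_const s)
  rw [← ofReal_integral_eq_lintegral_ofReal hIs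
    (ae_of_all _ fun z => by positivity), integral_add hI (integrable_const s)]
  congr 1
  simp only [h1, integral_const, probReal_univ, one_smul]
  rw [integral_finsetSum _ fun i _ => integrable_sq_add_inner_multivariateGaussian r _ _]
  simp only [integral_sq_add_inner_multivariateGaussian hr, EuclideanSpace.real_norm_sq_eq,
    Matrix.frobenius_norm_sq_eq_sum, Finset.sum_add_distrib, Finset.mul_sum]

end Gaussian

/-! ### Freezing the past, and a maximal inequality. -/

section Abstract

variable {Ω E : Type*} {mΩ : MeasurableSpace Ω} {P : Measure Ω}

theorem lintegral_comp_of_indepFun {S : Type*} [MeasurableSpace S] [MeasurableSpace E]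
    [IsProbabilityMeasure P] {X : Ω → S} {Z : Ω → E} (hX : Measurable X) (hZ : Measurable Z)
    (hind : IndepFun X Z P) {F : S × E → ℝ≥0∞} (hF : Measurable F) :
    ∫⁻ ω, F (X ω, Z ω) ∂P = ∫⁻ ω, ∫⁻ z, F (X ω, z) ∂(P.map Z) ∂P := by
  have hmap := (indepFun_iff_map_prod_eq_prod_map_map hX.aemeasurable hZ.aemeasurable).1 hind
  have : IsProbabilityMeasure (P.map Z) := Measure.isProbabilityMeasure_map hZ.aemeasurable
  have : IsProbabilityMeasure (P.map X) := Measure.isProbabilityMeasure_map hX.aemeasurable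
  rw [← lintegral_map hF (hX.prodMk hZ), hmap, lintegral_prod _ hF.aemeasurable,
    lintegral_map hF.lintegral_prod_right' hX]

/-- The identity, viewed as a random variable into `(Ω, 𝓕)`, generates `𝓕`, which reduces this to
two independent variables. It stands in for conditional expectation. -/
theorem lintegral_comp_of_indep [IsProbabilityMeasure P] [MeasurableSpace E]
    {𝓕 : MeasurableSpace Ω} (h𝓕 : 𝓕 ≤ mΩ) {Z : Ω → E} (hZ : Measurable[mΩ] Z)
    (hind : Indep 𝓕 (MeasurableSpace.comap Z inferInstance) P) {F : Ω × E → ℝ≥0∞}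
    (hF : Measurable[𝓕.prod inferInstance] F) :
    ∫⁻ ω, F (ω, Z ω) ∂P = ∫⁻ ω, ∫⁻ z, F (ω, z) ∂(@Measure.map _ _ mΩ _ Z P) ∂P := by
  refine @lintegral_comp_of_indepFun Ω E mΩ P Ω 𝓕 _ _ id Z (measurable_id'' h𝓕) hZ ?_ F hF
  rw [IndepFun_iff_Indep, MeasurableSpace.comap_id]
  exact hind

/-- A maximal inequality for nonnegative processes which grow at most by `c` in mean per step. -/
theorem mul_measure_exists_lt_le [IsProbabilityMeasure P] {𝓕 : ℕ → MeasurableSpace Ω}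
    (h𝓕 : ∀ n, 𝓕 n ≤ mΩ) (hmono : Monotone 𝓕) {H : ℕ → Ω → ℝ≥0∞}
    (hH : ∀ n, Measurable[𝓕 n] (H n)) {c : ℝ≥0∞}
    (hstep : ∀ n A, MeasurableSet[𝓕 n] A →
      ∫⁻ ω in A, H (n + 1) ω ∂P ≤ ∫⁻ ω in A, H n ω ∂P + c) (r : ℝ≥0∞) (n : ℕ) :
    r * P {ω | ∃ j ≤ n, r < H j ω} ≤ ∫⁻ ω, H 0 ω ∂P + n * c := by
  set B : ℕ → Set Ω := fun n => {ω | ∃ j ≤ n, r < H j ω} with hB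
  have hBm : ∀ n, MeasurableSet[𝓕 n] (B n) := by
    intro n
    have : B n = ⋃ j ∈ Set.Iic n, {ω | r < H j ω} := by ext ω; simp [hB]
    rw [this]
    refine MeasurableSet.biUnion (Set.to_countable _) fun j hj => ?_
    exact hmono hj _ (hH j measurableSet_Ioi)
  have hmark : ∀ n (A : Set Ω), MeasurableSet A → r * P (A ∩ {ω | r < H n ω})
      ≤ ∫⁻ ω in A ∩ {ω | r < H n ω}, H n ω ∂P := by
    intro n A hA
    have hm : MeasurableSet (A ∩ {ω | r < H n ω}) :=
      hA.inter (h𝓕 n _ (hH n measurableSet_Ioi))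
    rw [← setLIntegral_const]
    exact setLIntegral_mono' hm fun ω hω => hω.2.le
  -- The strengthened claim keeps the mass not yet stopped. The complement of `B n` lies in `𝓕 n`,
  -- so `hstep` applies there and costs one `c`.
  have key : ∀ n, r * P (B n) + ∫⁻ ω in (B n)ᶜ, H n ω ∂P ≤ ∫⁻ ω, H 0 ω ∂P + n * c := by
    intro n
    induction n with
    | zero =>
      have h0 := hmark 0 Set.univ MeasurableSet.univ
      have hB0 : B 0 = Set.univ ∩ {ω | r < H 0 ω} := by ext ω; simp [hB]
      rw [← hB0] at h0
      rw [Nat.cast_zero, zero_mul, add_zero]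
      exact (add_le_add_left h0 _).trans_eq (lintegral_add_compl (H 0) (h𝓕 0 _ (hBm 0)))
    | succ n ih =>
      have hmn : MeasurableSet (B n) := h𝓕 n _ (hBm n)
      have hBs : B (n + 1) = B n ∪ ((B n)ᶜ ∩ {ω | r < H (n + 1) ω}) := by
        ext ω
        simp only [hB, Set.mem_ofPred_eq, Set.mem_union, Set.mem_inter_iff, Set.mem_compl_iff]
        constructor
        · rintro ⟨j, hj, hr⟩
          by_cases h : ∃ j ≤ n, r < H j ω
          · exact Or.inl h
          · refine Or.inr ⟨h, ?_⟩
            rcases Nat.le_succ_iff.1 hj with h' | h'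
            · exact absurd ⟨j, h', hr⟩ h
            · rwa [h'] at hr
        · rintro (⟨j, hj, hr⟩ | ⟨-, hr⟩)
          · exact ⟨j, hj.trans n.le_succ, hr⟩
          · exact ⟨n + 1, le_rfl, hr⟩
      have hBc : (B (n + 1))ᶜ = (B n)ᶜ \ {ω | r < H (n + 1) ω} := by
        rw [hBs]; ext ω; simp only [Set.mem_compl_iff, Set.mem_union, Set.mem_inter_iff,
          Set.mem_sdiff]; tauto
      have hsm : MeasurableSet {ω | r < H (n + 1) ω} := h𝓕 _ _ (hH _ measurableSet_Ioi)
      calc r * P (B (n + 1)) + ∫⁻ ω in (B (n + 1))ᶜ, H (n + 1) ω ∂P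
          ≤ (r * P (B n) + r * P ((B n)ᶜ ∩ {ω | r < H (n + 1) ω}))
            + ∫⁻ ω in (B n)ᶜ \ {ω | r < H (n + 1) ω}, H (n + 1) ω ∂P := by
            rw [hBc, hBs, ← mul_add]
            gcongr
            exact measure_union_le _ _
        _ ≤ r * P (B n) + (∫⁻ ω in (B n)ᶜ ∩ {ω | r < H (n + 1) ω}, H (n + 1) ω ∂P
            + ∫⁻ ω in (B n)ᶜ \ {ω | r < H (n + 1) ω}, H (n + 1) ω ∂P) := by
            rw [add_assoc]
            gcongr
            exact hmark _ _ hmn.compl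
        _ = r * P (B n) + ∫⁻ ω in (B n)ᶜ, H (n + 1) ω ∂P := by
            rw [lintegral_inter_add_sdiff _ _ hsm]
        _ ≤ r * P (B n) + (∫⁻ ω in (B n)ᶜ, H n ω ∂P + c) := by
            gcongr
            exact hstep n _ (hBm n).compl
        _ ≤ (∫⁻ ω, H 0 ω ∂P + n * c) + c := by rw [← add_assoc]; gcongr
        _ = _ := by push_cast; ring
  exact le_self_add.trans (key n)

end Abstract

/-! ### Continuity of the coefficients and of one step. -/

section Continuity

variable {d m : ℕ}
  {f : EuclideanSpace ℝ (Fin d) → EuclideanSpace ℝ (Fin d) → EuclideanSpace ℝ (Fin d)}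
  {g : EuclideanSpace ℝ (Fin d) → EuclideanSpace ℝ (Fin d) → Matrix (Fin d) (Fin m) ℝ}

/-- The local Lipschitz condition enters the proof only through this continuity, which makes the
iterates measurable. -/
theorem continuous_uncurry_of_lipschitz_balls {E F : Type*} [NormedAddCommGroup E]
    [NormedAddCommGroup F] {h : E → E → F}
    (hh : ∀ R : ℝ, 0 < R → ∃ l : ℝ, 0 < l ∧ ∀ x x' y y' : E, ‖x‖ ≤ R → ‖x'‖ ≤ R → ‖y‖ ≤ R →
      ‖y'‖ ≤ R → ‖h x y - h x' y'‖ ≤ l * (‖x - x'‖ + ‖y - y'‖)) :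
    Continuous (Function.uncurry h) := by
  rw [continuous_iff_continuousAt]
  rintro ⟨x, y⟩
  obtain ⟨l, -, hl⟩ := hh (‖x‖ + ‖y‖ + 1) (by positivity)
  rw [ContinuousAt, tendsto_iff_norm_sub_tendsto_zero]
  have hlim : Tendsto (fun p : E × E => l * (‖p.1 - x‖ + ‖p.2 - y‖)) (nhds (x, y)) (nhds 0) := by
    have : Continuous fun p : E × E => l * (‖p.1 - x‖ + ‖p.2 - y‖) := by fun_prop
    simpa using this.tendsto (x, y)
  refine squeeze_zero' (Eventually.of_forall fun _ => norm_nonneg _) ?_ hlim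
  have h1 : ∀ᶠ p : E × E in nhds (x, y), ‖p.1‖ < ‖x‖ + ‖y‖ + 1 :=
    (continuous_fst.norm.tendsto (x, y)).eventually_lt_const
      (by dsimp only; linarith [norm_nonneg y])
  have h2 : ∀ᶠ p : E × E in nhds (x, y), ‖p.2‖ < ‖x‖ + ‖y‖ + 1 :=
    (continuous_snd.norm.tendsto (x, y)).eventually_lt_const
      (by dsimp only; linarith [norm_nonneg x])
  filter_upwards [h1, h2] with p hp1 hp2
  exact hl _ _ _ _ hp1.le (by linarith [norm_nonneg y]) hp2.le (by linarith [norm_nonneg x])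

theorem LocallyLipschitzCoeff.continuous_drift (h : LocallyLipschitzCoeff f g) :
    Continuous (Function.uncurry f) := by
  refine continuous_uncurry_of_lipschitz_balls fun R hR => ?_
  obtain ⟨l, hl, hb⟩ := h R hR
  exact ⟨l, hl, fun x x' y y' h1 h2 h3 h4 =>
    (le_max_left _ _).trans (hb x x' y y' h1 h2 h3 h4)⟩

theorem LocallyLipschitzCoeff.continuous_diffusion (h : LocallyLipschitzCoeff f g) :
    Continuous (Function.uncurry g) := by
  refine continuous_uncurry_of_lipschitz_balls fun R hR => ?_
  obtain ⟨l, hl, hb⟩ := h R hR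
  exact ⟨l, hl, fun x x' y y' h1 h2 h3 h4 =>
    (le_max_right _ _).trans (hb x x' y y' h1 h2 h3 h4)⟩

theorem continuous_toEuclideanLin_apply :
    Continuous fun p : Matrix (Fin d) (Fin m) ℝ × EuclideanSpace ℝ (Fin m) =>
      Matrix.toEuclideanLin p.1 p.2 := by
  have hent : ∀ i j, Continuous fun A : Matrix (Fin d) (Fin m) ℝ => A i j := fun i j =>
    (Matrix.entryLinearMap ℝ ℝ i j).continuous_of_finiteDimensional
  have hsum : Continuous fun p : Matrix (Fin d) (Fin m) ℝ × EuclideanSpace ℝ (Fin m) =>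
      fun i => ∑ j, p.1 i j * p.2 j :=
    continuous_pi fun i => continuous_finsetSum _ fun j _ =>
      ((hent i j).comp continuous_fst).mul ((PiLp.continuous_apply 2 _ j).comp continuous_snd)
  exact (PiLp.continuous_toLp 2 _).comp hsum

/-- One untruncated Euler-Maruyama step, as a function of the current state, the delayed state
and the driving increment, is continuous. -/
theorem LocallyLipschitzCoeff.continuous_step (h : LocallyLipschitzCoeff f g) (Δ : ℝ) :
    Continuous fun p : (EuclideanSpace ℝ (Fin d) × EuclideanSpace ℝ (Fin d))
        × EuclideanSpace ℝ (Fin m) =>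
      p.1.1 + Δ • f p.1.1 p.1.2 + Matrix.toEuclideanLin (g p.1.1 p.1.2) p.2 := by
  have hf : Continuous fun p : (EuclideanSpace ℝ (Fin d) × EuclideanSpace ℝ (Fin d))
      × EuclideanSpace ℝ (Fin m) => f p.1.1 p.1.2 := h.continuous_drift.comp continuous_fst
  have hg : Continuous fun p : (EuclideanSpace ℝ (Fin d) × EuclideanSpace ℝ (Fin d))
      × EuclideanSpace ℝ (Fin m) => Matrix.toEuclideanLin (g p.1.1 p.1.2) p.2 :=
    continuous_toEuclideanLin_apply.comp
      ((h.continuous_diffusion.comp continuous_fst).prodMk continuous_snd)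
  exact ((continuous_fst.comp continuous_fst).add (hf.const_smul Δ)).add hg

end Continuity

/-! ### Brownian increments and their filtration. -/

section Increments

variable {m : ℕ} {Ω : Type*}

/-- The σ-algebra generated by the first `k` increments of the driving process. -/
@[reducible] noncomputable def incrementSigma (τ : ℝ) (N : ℕ+)
    (W : ℝ≥0 → Ω → EuclideanSpace ℝ (Fin m)) (k : ℕ) :
    MeasurableSpace Ω :=
  ⨆ i ∈ Set.Iio k, MeasurableSpace.comap
    (fun ω => pathIncrement τ N (fun t => W t ω) (i : ℕ)) inferInstance

theorem incrementSigma_mono (τ : ℝ) (N : ℕ+) (W : ℝ≥0 → Ω → EuclideanSpace ℝ (Fin m)) :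
    Monotone (incrementSigma τ N W) := fun _ _ h =>
  biSup_mono fun _ hi => lt_of_lt_of_le hi h

theorem measurable_pathIncrement_incrementSigma (τ : ℝ) (N : ℕ+)
    (W : ℝ≥0 → Ω → EuclideanSpace ℝ (Fin m)) (k : ℕ) :
    Measurable[incrementSigma τ N W (k + 1)]
      fun ω => pathIncrement τ N (fun t => W t ω) (k : ℕ) := by
  refine Measurable.mono (comap_measurable _) ?_ le_rfl
  exact le_biSup (fun i : ℕ => MeasurableSpace.comap
    (fun ω => pathIncrement τ N (fun t => W t ω) (i : ℕ)) inferInstance)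
    (Set.mem_Iio.2 k.lt_succ_self)

variable [MeasurableSpace Ω] {P : Measure Ω}
  {W : ℝ≥0 → Ω → EuclideanSpace ℝ (Fin m)}

theorem IsBrownianMotion.measurable_pathIncrement (hW : IsBrownianMotion W P) (τ : ℝ) (N : ℕ+)
    (k : ℤ) : Measurable fun ω => pathIncrement τ N (fun t => W t ω) k :=
  (hW.measurable _).sub (hW.measurable _)

theorem IsBrownianMotion.iIndepFun_pathIncrement (hW : IsBrownianMotion W P) {τ : ℝ} (hτ : 0 < τ)
    (N : ℕ+) : iIndepFun (fun (k : ℕ) ω => pathIncrement τ N (fun t => W t ω) k) P := by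
  have ht : Monotone fun k : ℕ => Real.toNNReal ((k : ℝ) * stepSize τ N) := by
    intro i j hij
    have := (stepSize_pos hτ N).le
    have : (i : ℝ) ≤ j := by exact_mod_cast hij
    exact Real.toNNReal_le_toNNReal (by gcongr)
  have := hW.indep_increments.nat ht
  simpa [pathIncrement] using this

theorem IsBrownianMotion.map_pathIncrement (hW : IsBrownianMotion W P) {τ : ℝ} (hτ : 0 < τ)
    (N : ℕ+) (k : ℕ) :
    P.map (fun ω => pathIncrement τ N (fun t => W t ω) k)
      = multivariateGaussian 0 (stepSize τ N • (1 : Matrix (Fin m) (Fin m) ℝ)) := by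
  have hΔ := stepSize_pos hτ N
  have h0 : (0 : ℝ) ≤ k * stepSize τ N := by positivity
  have h1 : (0 : ℝ) ≤ (k + 1) * stepSize τ N := by positivity
  have h := (hW.law_increments (Real.toNNReal ((k : ℝ) * stepSize τ N))
    (Real.toNNReal (((k : ℝ) + 1) * stepSize τ N))
    (Real.toNNReal_le_toNNReal (by gcongr; linarith))).map_eq
  rw [Real.coe_toNNReal _ h0, Real.coe_toNNReal _ h1] at h
  have e : ((k : ℝ) + 1) * stepSize τ N - k * stepSize τ N = stepSize τ N := by ring
  rw [e] at h
  simpa [pathIncrement] using h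

theorem IsBrownianMotion.incrementSigma_le (hW : IsBrownianMotion W P) (τ : ℝ) (N : ℕ+) (k : ℕ) :
    incrementSigma τ N W k ≤ ‹MeasurableSpace Ω› :=
  iSup₂_le fun _ _ => (hW.measurable_pathIncrement τ N _).comap_le

theorem IsBrownianMotion.indep_incrementSigma (hW : IsBrownianMotion W P) {τ : ℝ} (hτ : 0 < τ)
    (N : ℕ+) (k : ℕ) :
    Indep (incrementSigma τ N W k) (MeasurableSpace.comap
      (fun ω => pathIncrement τ N (fun t => W t ω) (k : ℕ)) inferInstance) P := by
  have h := indep_iSup_of_disjoint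
    (fun i : ℕ => (hW.measurable_pathIncrement τ N i).comap_le)
    (hW.iIndepFun_pathIncrement hτ N).iIndep
    (S := Set.Iio k) (T := {k}) (by simp)
  simpa [incrementSigma] using h

end Increments

/-! ### Segments, adaptedness and the conditional step. -/

section Scheme

variable {d m : ℕ}
  {f : EuclideanSpace ℝ (Fin d) → EuclideanSpace ℝ (Fin d) → EuclideanSpace ℝ (Fin d)}
  {g : EuclideanSpace ℝ (Fin d) → EuclideanSpace ℝ (Fin d) → Matrix (Fin d) (Fin m) ℝ}
  {Φ : Set.Ici (1 : ℝ) → ℝ≥0} {ν τ : ℝ}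

theorem norm_initPath_le (hτ : 0 < τ) {ξ : C(Set.Icc (-τ) 0, EuclideanSpace ℝ (Fin d))} {M : ℝ}
    (hξ : ‖ξ‖ ≤ M) (t : ℝ) : ‖initPath hτ ξ t‖ ≤ M :=
  (ξ.norm_coe_le_norm _).trans hξ

theorem norm_truncEM_le_of_nonpos (hτ : 0 < τ) (N : ℕ+)
    {ξ : C(Set.Icc (-τ) 0, EuclideanSpace ℝ (Fin d))} {M : ℝ} (hξ : ‖ξ‖ ≤ M)
    (w : ℝ≥0 → EuclideanSpace ℝ (Fin m)) {k : ℤ} (hk : k ≤ 0) :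
    ‖truncEM f g Φ ν hτ N ξ w k‖ ≤ M := by
  rw [truncEM_of_nonpos f g Φ ν hτ N ξ w hk]
  exact (norm_truncMap_le _ _ _).trans (norm_initPath_le hτ hξ _)

theorem norm_truncEM_le_truncRadius (hτ : 0 < τ) (N : ℕ+)
    (ξ : C(Set.Icc (-τ) 0, EuclideanSpace ℝ (Fin d))) (w : ℝ≥0 → EuclideanSpace ℝ (Fin m))
    (k : ℤ) : ‖truncEM f g Φ ν hτ N ξ w k‖ ≤ truncRadius f g Φ ν (stepSize τ N) :=
  norm_truncMap_le_truncRadius _ _ _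

/-- The segment at time `t_k` is bounded as soon as the initial path and the iterates on a
window of length `N + 1` before `k` are. -/
theorem norm_temsp_le (hτ : 0 < τ) (N : ℕ+) {ξ : C(Set.Icc (-τ) 0, EuclideanSpace ℝ (Fin d))}
    (w : ℝ≥0 → EuclideanSpace ℝ (Fin m)) (k : ℕ) {r : ℝ} (hξ : ‖ξ‖ ≤ r)
    (hu : ∀ j : ℕ, k ≤ j + (N + 1) → j ≤ k → ‖truncEM f g Φ ν hτ N ξ w j‖ ≤ r) :
    ‖temsp f g Φ ν hτ N ξ w k‖ ≤ r := by
  have hΔ := stepSize_pos hτ N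
  have hN : stepSize τ N * (N : ℕ) = τ :=
    div_mul_cancel₀ _ (by exact_mod_cast N.pos.ne')
  refine (ContinuousMap.norm_le _ ((norm_nonneg _).trans hξ)).2 fun θ => ?_
  change ‖interpEM f g Φ ν hτ N ξ w ((k : ℝ) * stepSize τ N + θ)‖ ≤ r
  set t := (k : ℝ) * stepSize τ N + θ with ht
  obtain ⟨hθ1, hθ2⟩ := θ.2
  rcases le_or_gt t 0 with h0 | h0
  · rw [interpEM, if_pos h0]
    exact (norm_truncMap_le _ _ _).trans (norm_initPath_le hτ hξ _)
  · have hpos : 0 < t / stepSize τ N := div_pos h0 hΔ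
    -- The ceiling keeps `j + 1 ≤ k` even at `t = t_k`, where the floor would call for the iterate
    -- `k + 1`.
    obtain ⟨j, hj⟩ : ∃ j, ⌈t / stepSize τ N⌉₊ = j + 1 :=
      ⟨_, (Nat.succ_pred_eq_of_pos (Nat.ceil_pos.2 hpos)).symm⟩
    have h1 : (j : ℝ) * stepSize τ N < t := by
      rw [← lt_div_iff₀ hΔ]
      exact Nat.lt_ceil.1 (by omega)
    have h2 : t ≤ ((j : ℝ) + 1) * stepSize τ N := by
      rw [← div_le_iff₀ hΔ]
      have := Nat.le_ceil (t / stepSize τ N)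
      rw [hj] at this
      exact_mod_cast this
    have hjk : j < k := by
      have : (j : ℝ) * stepSize τ N < k * stepSize τ N := by linarith
      exact_mod_cast lt_of_mul_lt_mul_right this hΔ.le
    have hkj : k ≤ j + 1 + (N : ℕ) := by
      have : (k : ℝ) * stepSize τ N ≤ ((j : ℝ) + 1 + (N : ℕ)) * stepSize τ N := by linarith
      exact_mod_cast le_of_mul_le_mul_right this hΔ
    rw [interpEM_of_mem_Icc f g Φ ν hτ N ξ w (k := j) ⟨h1.le, h2⟩]
    have hu1 := hu j (by omega) hjk.le
    have hu2 := hu (j + 1) (by omega) hjk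
    push_cast at hu2
    have c1 : 0 ≤ (((j : ℝ) + 1) * stepSize τ N - t) / stepSize τ N :=
      div_nonneg (by linarith) hΔ.le
    have c2 : 0 ≤ (t - (j : ℝ) * stepSize τ N) / stepSize τ N :=
      div_nonneg (by linarith) hΔ.le
    refine (norm_add_le _ _).trans ?_
    rw [norm_smul, norm_smul, Real.norm_of_nonneg c1, Real.norm_of_nonneg c2]
    refine (add_le_add (mul_le_mul_of_nonneg_left hu1 c1)
      (mul_le_mul_of_nonneg_left hu2 c2)).trans_eq ?_
    field_simp
    ring

variable {Ω : Type*}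

theorem LocallyLipschitzCoeff.measurable_truncEM (hH1 : LocallyLipschitzCoeff f g)
    (W : ℝ≥0 → Ω → EuclideanSpace ℝ (Fin m)) (hτ : 0 < τ) (N : ℕ+)
    (ξ : C(Set.Icc (-τ) 0, EuclideanSpace ℝ (Fin d))) (k : ℕ) (j : ℤ) (hj : j ≤ k) :
    Measurable[incrementSigma τ N W k] fun ω => truncEM f g Φ ν hτ N ξ (fun t => W t ω) j := by
  induction k generalizing j with
  | zero =>
    simp only [truncEM_of_nonpos f g Φ ν hτ N ξ _ (by simpa using hj : j ≤ 0)]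
    exact measurable_const
  | succ k ih =>
    have ih' : ∀ j : ℤ, j ≤ k → Measurable[incrementSigma τ N W (k + 1)]
        fun ω => truncEM f g Φ ν hτ N ξ (fun t => W t ω) j := fun j hj =>
      (ih j hj).mono (incrementSigma_mono τ N W k.le_succ) le_rfl
    rcases (show j ≤ k ∨ j = (k : ℤ) + 1 by push_cast at hj; omega) with h | rfl
    · exact ih' j h
    · simp only [truncEM_succ f g Φ ν hτ N ξ _ (Int.natCast_nonneg k)]
      exact (continuous_truncMap f g Φ ν _).measurable.comp
        ((hH1.continuous_step (stepSize τ N)).measurable.comp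
          (((ih' _ le_rfl).prodMk (ih' _ (by omega))).prodMk
            (measurable_pathIncrement_incrementSigma τ N W k)))

/-- The sum at `j` uses iterates up to `j - 1` only, so `j = k + 1` is allowed: the next delay sum
is already known at step `k`. -/
theorem LocallyLipschitzCoeff.measurable_delaySum (hH1 : LocallyLipschitzCoeff f g)
    (W : ℝ≥0 → Ω → EuclideanSpace ℝ (Fin m)) (hτ : 0 < τ) (N : ℕ+)
    (ξ : C(Set.Icc (-τ) 0, EuclideanSpace ℝ (Fin d))) (α c a : ℝ) (k : ℕ) (j : ℤ)
    (hj : j ≤ k + 1) :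
    Measurable[incrementSigma τ N W k] fun ω =>
      delaySum α c a N (truncEM f g Φ ν hτ N ξ fun t => W t ω) j := by
  let _ : MeasurableSpace Ω := incrementSigma τ N W k
  unfold delaySum
  refine Finset.measurable_fun_sum _ fun i _ => ?_
  exact ((hH1.measurable_truncEM W hτ N ξ k _ (by omega)).norm.pow_const α).const_mul _

theorem LocallyLipschitzCoeff.measurable_lyapunov (hH1 : LocallyLipschitzCoeff f g)
    (W : ℝ≥0 → Ω → EuclideanSpace ℝ (Fin m)) (hτ : 0 < τ) (N : ℕ+)
    (ξ : C(Set.Icc (-τ) 0, EuclideanSpace ℝ (Fin d))) (α c a Δ : ℝ) (k : ℕ) :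
    Measurable[incrementSigma τ N W k] fun ω =>
      lyapunov α c a Δ N (truncEM f g Φ ν hτ N ξ fun t => W t ω) k := by
  let _ : MeasurableSpace Ω := incrementSigma τ N W k
  unfold lyapunov
  exact ((hH1.measurable_truncEM W hτ N ξ k _ le_rfl).norm.pow_const 2).add
    ((hH1.measurable_delaySum W hτ N ξ α c a k _ (by omega)).const_mul _)

/-- The σ-algebra on `Ω` is left free so that it can be taken to be `incrementSigma`. -/
theorem LocallyLipschitzCoeff.measurable_indicator_mul_step (hH1 : LocallyLipschitzCoeff f g)
    [MeasurableSpace Ω] (Δ : ℝ) {u v : Ω → EuclideanSpace ℝ (Fin d)} (hu : Measurable u)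
    (hv : Measurable v) {s : Ω → ℝ} (hs : Measurable s) {A : Set Ω} (hA : MeasurableSet A) :
    Measurable fun p : Ω × EuclideanSpace ℝ (Fin m) => A.indicator 1 p.1 *
      ENNReal.ofReal (‖u p.1 + Δ • f (u p.1) (v p.1)
        + Matrix.toEuclideanLin (g (u p.1) (v p.1)) p.2‖ ^ 2 + s p.1) := by
  refine Measurable.mul (Measurable.comp (Measurable.indicator measurable_one hA)
    measurable_fst) ?_
  refine ENNReal.measurable_ofReal.comp (Measurable.add (Measurable.pow_const ?_ 2)
    (hs.comp measurable_fst))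
  exact Measurable.norm ((hH1.continuous_step Δ).measurable.comp
    (((hu.comp measurable_fst).prodMk (hv.comp measurable_fst)).prodMk measurable_snd))

variable {mΩ : MeasurableSpace Ω} {P : Measure Ω} [IsProbabilityMeasure P]
  {W : ℝ≥0 → Ω → EuclideanSpace ℝ (Fin m)}

/-- The conditional second moment of one step of the scheme, tested on an event of the past. -/
theorem lintegral_norm_sq_truncEM_succ_le (hW : IsBrownianMotion W P)
    (hH1 : LocallyLipschitzCoeff f g) (hτ : 0 < τ) (N : ℕ+)
    (ξ : C(Set.Icc (-τ) 0, EuclideanSpace ℝ (Fin d))) (k : ℕ) {s : Ω → ℝ} (hs0 : ∀ ω, 0 ≤ s ω)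
    (hs : Measurable[incrementSigma τ N W k] s) {A : Set Ω}
    (hA : MeasurableSet[incrementSigma τ N W k] A) :
    ∫⁻ ω in A, ENNReal.ofReal
        (‖truncEM f g Φ ν hτ N ξ (fun t => W t ω) (k + 1)‖ ^ 2 + s ω) ∂P
      ≤ ∫⁻ ω in A, ENNReal.ofReal
        (‖truncEM f g Φ ν hτ N ξ (fun t => W t ω) k
            + stepSize τ N • f (truncEM f g Φ ν hτ N ξ (fun t => W t ω) k)
              (truncEM f g Φ ν hτ N ξ (fun t => W t ω) (k - (N : ℕ)))‖ ^ 2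
          + stepSize τ N * ‖g (truncEM f g Φ ν hτ N ξ (fun t => W t ω) k)
              (truncEM f g Φ ν hτ N ξ (fun t => W t ω) (k - (N : ℕ)))‖ ^ 2 + s ω) ∂P := by
  have h𝓕 : incrementSigma τ N W k ≤ mΩ := hW.incrementSigma_le τ N k
  have hA' : MeasurableSet[mΩ] A := h𝓕 _ hA
  have hum := hH1.measurable_truncEM (Φ := Φ) (ν := ν) W hτ N ξ k k le_rfl
  have hvm := hH1.measurable_truncEM (Φ := Φ) (ν := ν) W hτ N ξ k (k - (N : ℕ)) (by omega)
  have hFm := @LocallyLipschitzCoeff.measurable_indicator_mul_step d m f g Ω hH1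
    (incrementSigma τ N W k) (stepSize τ N) _ _ hum hvm s hs A hA
  have key := lintegral_comp_of_indep h𝓕 (hW.measurable_pathIncrement τ N k)
    (hW.indep_incrementSigma hτ N k) hFm
  rw [hW.map_pathIncrement hτ N k] at key
  rw [← lintegral_indicator hA', ← lintegral_indicator hA']
  refine le_trans ?_ (key.trans_le ?_)
  · refine lintegral_mono fun ω => ?_
    by_cases hω : ω ∈ A
    · simp only [hω, Set.indicator_of_mem, Pi.one_apply, one_mul]
      refine ENNReal.ofReal_le_ofReal (add_le_add_left ?_ _)
      gcongr
      -- Truncation does not increase the norm; this is the only loss in the estimate.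
      rw [truncEM_succ f g Φ ν hτ N ξ _ (Int.natCast_nonneg k)]
      exact norm_truncMap_le _ _ _
    · simp [hω]
  · refine lintegral_mono fun ω => ?_
    by_cases hω : ω ∈ A
    · simp only [hω, Set.indicator_of_mem, Pi.one_apply, one_mul]
      exact (lintegral_norm_sq_add_multivariateGaussian (stepSize_pos hτ N).le (hs0 ω) _ _).le
    · simp [hω]

end Scheme

/-! ### Uniform moments and the tail of the segment. -/

section MomentBounds

variable {d m : ℕ}
  {f : EuclideanSpace ℝ (Fin d) → EuclideanSpace ℝ (Fin d) → EuclideanSpace ℝ (Fin d)}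
  {g : EuclideanSpace ℝ (Fin d) → EuclideanSpace ℝ (Fin d) → Matrix (Fin d) (Fin m) ℝ}
  {Φ : Set.Ici (1 : ℝ) → ℝ≥0} {ν τ : ℝ} {Ω : Type*} {mΩ : MeasurableSpace Ω} {P : Measure Ω}
  [IsProbabilityMeasure P] {W : ℝ≥0 → Ω → EuclideanSpace ℝ (Fin m)}

/-- The drift condition of the Lyapunov functional along the scheme, tested on an event of the
past. -/
theorem lintegral_lyapunov_succ_le (hW : IsBrownianMotion W P)
    (hH1 : LocallyLipschitzCoeff f g) (hτ : 0 < τ) (N : ℕ+)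
    (ξ : C(Set.Icc (-τ) 0, EuclideanSpace ℝ (Fin d))) {α a b c C κ : ℝ} (hα : 2 ≤ α)
    (ha : 0 ≤ a) (hac : a < c) (hκ0 : 0 ≤ κ) (hκ1 : κ ≤ b - c) (hκ2 : κ ≤ (c - a) / (τ * c))
    (hstep : ∀ x y : EuclideanSpace ℝ (Fin d), ‖x‖ ≤ truncRadius f g Φ ν (stepSize τ N) →
      ‖y‖ ≤ truncRadius f g Φ ν (stepSize τ N) →
      ‖x + stepSize τ N • f x y‖ ^ 2 + stepSize τ N * ‖g x y‖ ^ 2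
        ≤ ‖x‖ ^ 2 + stepSize τ N * (C - b * ‖x‖ ^ α + a * ‖y‖ ^ α))
    (k : ℕ) {A : Set Ω} (hA : MeasurableSet[incrementSigma τ N W k] A) :
    ∫⁻ ω in A, ENNReal.ofReal (lyapunov α c a (stepSize τ N) N
        (truncEM f g Φ ν hτ N ξ fun t => W t ω) ((k + 1 : ℕ) : ℤ)) ∂P
      ≤ ∫⁻ ω in A, ENNReal.ofReal ((1 - κ * stepSize τ N) * lyapunov α c a (stepSize τ N) N
        (truncEM f g Φ ν hτ N ξ fun t => W t ω) k + stepSize τ N * (C + κ)) ∂P := by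
  have hΔ := stepSize_pos hτ N
  have hN : stepSize τ N * (N : ℕ) = τ :=
    div_mul_cancel₀ _ (by exact_mod_cast N.pos.ne')
  push_cast
  refine (lintegral_norm_sq_truncEM_succ_le hW hH1 hτ N ξ k
    (s := fun ω => stepSize τ N * delaySum α c a N
      (truncEM f g Φ ν hτ N ξ fun t => W t ω) (k + 1))
    (fun ω => mul_nonneg hΔ.le (delaySum_nonneg ha hac.le _ _))
    ((hH1.measurable_delaySum W hτ N ξ α c a k _ le_rfl).const_mul _) hA).trans ?_
  refine lintegral_mono fun ω => ENNReal.ofReal_le_ofReal ?_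
  exact add_delaySum_succ_le hα ha hac N.pos.ne' hΔ.le hτ hN hκ0 hκ1 hκ2
    (hstep _ _ (norm_truncEM_le_truncRadius hτ N ξ _ _) (norm_truncEM_le_truncRadius hτ N ξ _ _))

/-- A nonnegative process that contracts in mean up to an additive constant has bounded mean. -/
theorem lintegral_ofReal_le_of_contraction {H : ℕ → Ω → ℝ} (hH : ∀ k, Measurable (H k))
    (hH0 : ∀ k ω, 0 ≤ H k ω) {q C B : ℝ} (hq : 0 ≤ q) (hC : 0 ≤ C) (hB : 0 ≤ B)
    (hqB : q * B + C ≤ B)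
    (hstep : ∀ k, ∫⁻ ω, ENNReal.ofReal (H (k + 1) ω) ∂P
      ≤ ∫⁻ ω, ENNReal.ofReal (q * H k ω + C) ∂P) (hinit : ∀ ω, H 0 ω ≤ B) (k : ℕ) :
    ∫⁻ ω, ENNReal.ofReal (H k ω) ∂P ≤ ENNReal.ofReal B := by
  induction k with
  | zero =>
    refine (lintegral_mono fun ω => ENNReal.ofReal_le_ofReal (hinit ω)).trans ?_
    simp
  | succ k ih =>
    calc ∫⁻ ω, ENNReal.ofReal (H (k + 1) ω) ∂P
        ≤ ∫⁻ ω, ENNReal.ofReal (q * H k ω + C) ∂P := hstep k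
      _ = ∫⁻ ω, (ENNReal.ofReal q * ENNReal.ofReal (H k ω) + ENNReal.ofReal C) ∂P := by
          refine lintegral_congr fun ω => ?_
          rw [ENNReal.ofReal_add (mul_nonneg hq (hH0 k ω)) hC, ENNReal.ofReal_mul hq]
      _ = ENNReal.ofReal q * ∫⁻ ω, ENNReal.ofReal (H k ω) ∂P + ENNReal.ofReal C := by
          rw [lintegral_add_right _ measurable_const,
            lintegral_const_mul _ (hH k).ennreal_ofReal]
          simp
      _ ≤ ENNReal.ofReal q * ENNReal.ofReal B + ENNReal.ofReal C := by gcongr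
      _ = ENNReal.ofReal (q * B + C) := by
          rw [← ENNReal.ofReal_mul hq, ENNReal.ofReal_add (mul_nonneg hq hB) hC]
      _ ≤ ENNReal.ofReal B := ENNReal.ofReal_le_ofReal hqB

theorem mul_measure_norm_temsp_gt_le (hW : IsBrownianMotion W P)
    (hH1 : LocallyLipschitzCoeff f g) (hτ : 0 < τ) (N : ℕ+) (hΔ1 : stepSize τ N ≤ 1)
    {M : ℝ} (hM : 0 ≤ M) {ξ : C(Set.Icc (-τ) 0, EuclideanSpace ℝ (Fin d))} (hξ : ‖ξ‖ ≤ M)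
    {α a b c C κ : ℝ} (hα : 2 ≤ α)
    (ha : 0 ≤ a) (hac : a < c) (hC : 0 ≤ C) (hκ0 : 0 < κ) (hκ : κ ≤ 1) (hκ1 : κ ≤ b - c)
    (hκ2 : κ ≤ (c - a) / (τ * c))
    (hstep : ∀ x y : EuclideanSpace ℝ (Fin d), ‖x‖ ≤ truncRadius f g Φ ν (stepSize τ N) →
      ‖y‖ ≤ truncRadius f g Φ ν (stepSize τ N) →
      ‖x + stepSize τ N • f x y‖ ^ 2 + stepSize τ N * ‖g x y‖ ^ 2
        ≤ ‖x‖ ^ 2 + stepSize τ N * (C - b * ‖x‖ ^ α + a * ‖y‖ ^ α))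
    {r : ℝ} (hr : M ≤ r) (k : ℕ) :
    ENNReal.ofReal (r ^ 2) * P {ω | r < ‖temsp f g Φ ν hτ N ξ (fun t => W t ω) k‖}
      ≤ ENNReal.ofReal (max (M ^ 2 + τ * c * M ^ α) ((C + κ) / κ) + 2 * τ * (C + κ)) := by
  have hΔ := stepSize_pos hτ N
  have hN : stepSize τ N * (N : ℕ) = τ :=
    div_mul_cancel₀ _ (by exact_mod_cast N.pos.ne')
  have hN1 : (1 : ℝ) ≤ (N : ℕ) := by exact_mod_cast N.pos
  -- The first entry bounds the initial functional; the second is the fixed point of the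
  -- contraction, independent of the step size.
  set B := max (M ^ 2 + τ * c * M ^ α) ((C + κ) / κ) with hB
  have hB1 : C + κ ≤ κ * B := by
    have := le_max_right (M ^ 2 + τ * c * M ^ α) ((C + κ) / κ)
    rw [← hB, div_le_iff₀ hκ0] at this
    linarith
  have hB0 : 0 ≤ B := (by positivity : 0 ≤ (C + κ) / κ).trans (le_max_right _ _)
  set H : ℕ → Ω → ℝ := fun k ω => lyapunov α c a (stepSize τ N) N
    (truncEM f g Φ ν hτ N ξ fun t => W t ω) k with hH
  have hH0 : ∀ k ω, 0 ≤ H k ω := fun k ω => lyapunov_nonneg ha hac.le hΔ.le _ _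
  have hHm : ∀ k, Measurable[incrementSigma τ N W k] (H k) := fun k =>
    hH1.measurable_lyapunov W hτ N ξ α c a _ k
  have hHm' : ∀ k, Measurable (H k) := fun k =>
    (hHm k).mono (hW.incrementSigma_le τ N k) le_rfl
  have hdrift : ∀ (k : ℕ) (A : Set Ω), MeasurableSet[incrementSigma τ N W k] A →
      ∫⁻ ω in A, ENNReal.ofReal (H (k + 1) ω) ∂P
        ≤ ∫⁻ ω in A, ENNReal.ofReal ((1 - κ * stepSize τ N) * H k ω
          + stepSize τ N * (C + κ)) ∂P := fun k A hA =>
    lintegral_lyapunov_succ_le hW hH1 hτ N ξ hα ha hac hκ0.le hκ1 hκ2 hstep k hA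
  have hmoment : ∀ k, ∫⁻ ω, ENNReal.ofReal (H k ω) ∂P ≤ ENNReal.ofReal B := by
    refine lintegral_ofReal_le_of_contraction hHm' hH0 (q := 1 - κ * stepSize τ N)
      (C := stepSize τ N * (C + κ)) (by nlinarith) (by positivity) hB0 (by nlinarith)
      (fun k => ?_) fun ω => ?_
    · simpa using hdrift k Set.univ MeasurableSet.univ
    · refine (lyapunov_le (M := M) (by linarith) (ha.trans hac.le) hac.le hΔ.le
        fun j hj => norm_truncEM_le_of_nonpos hτ N hξ _ (by simpa using hj)).trans ?_
      rw [hN]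
      exact le_max_left _ _
  have hgrow : ∀ (k : ℕ) (A : Set Ω), MeasurableSet[incrementSigma τ N W k] A →
      ∫⁻ ω in A, ENNReal.ofReal (H (k + 1) ω) ∂P
        ≤ ∫⁻ ω in A, ENNReal.ofReal (H k ω) ∂P
          + ENNReal.ofReal (stepSize τ N * (C + κ)) := by
    intro k A hA
    refine (hdrift k A hA).trans ?_
    calc ∫⁻ ω in A, ENNReal.ofReal ((1 - κ * stepSize τ N) * H k ω
          + stepSize τ N * (C + κ)) ∂P
        ≤ ∫⁻ ω in A, (ENNReal.ofReal (H k ω) + ENNReal.ofReal (stepSize τ N * (C + κ))) ∂P := by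
          refine lintegral_mono fun ω => ?_
          rw [← ENNReal.ofReal_add (hH0 k ω) (by positivity)]
          refine ENNReal.ofReal_le_ofReal (add_le_add_left ?_ _)
          have := mul_nonneg (mul_nonneg hκ0.le hΔ.le) (hH0 k ω)
          linarith
      _ ≤ _ := by
          rw [lintegral_add_right _ measurable_const, setLIntegral_const]
          gcongr
          exact mul_le_of_le_one_right' prob_le_one
  -- Truncated subtraction: for small `k` the window starts at `0`, and the initial path covers
  -- earlier times.
  set s := k - (N + 1) with hs
  have hmax := mul_measure_exists_lt_le (P := P) (𝓕 := fun j => incrementSigma τ N W (s + j))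
    (fun j => hW.incrementSigma_le τ N _)
    (fun i j hij => incrementSigma_mono τ N W (by omega))
    (H := fun j ω => ENNReal.ofReal (H (s + j) ω))
    (fun j => ENNReal.measurable_ofReal.comp (hHm (s + j)))
    (fun j A hA => hgrow (s + j) A hA) (ENNReal.ofReal (r ^ 2)) (N + 1)
  have hsub : {ω | r < ‖temsp f g Φ ν hτ N ξ (fun t => W t ω) k‖} ⊆
      {ω | ∃ j ≤ (N : ℕ) + 1, ENNReal.ofReal (r ^ 2) < ENNReal.ofReal (H (s + j) ω)} := by
    intro ω hω
    by_contra hcon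
    simp only [Set.mem_ofPred_eq, not_exists, not_and, not_lt] at hcon
    refine absurd (norm_temsp_le hτ N (fun t => W t ω) k (hξ.trans hr) fun j hj1 hj2 => ?_)
      (not_le.2 hω)
    have h1 := hcon (j - s) (by omega)
    rw [show s + (j - s) = j by omega, ENNReal.ofReal_le_ofReal_iff (sq_nonneg _)] at h1
    exact (sq_le_sq₀ (norm_nonneg _) (hM.trans hr)).1 ((sq_le_lyapunov ha hac.le hΔ.le _ _).trans h1)
  calc ENNReal.ofReal (r ^ 2) * P {ω | r < ‖temsp f g Φ ν hτ N ξ (fun t => W t ω) k‖}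
      ≤ _ := mul_le_mul_right (measure_mono hsub) _
    _ ≤ _ := hmax
    _ ≤ ENNReal.ofReal B + ENNReal.ofReal (2 * τ * (C + κ)) := by
        refine add_le_add (hmoment _) ?_
        rw [← ENNReal.ofReal_natCast, ← ENNReal.ofReal_mul (by positivity)]
        refine ENNReal.ofReal_le_ofReal ?_
        -- The product is `τ + Δ`, and `Δ ≤ τ` since `N ≥ 1`.
        have h2 : ((N + 1 : ℕ) : ℝ) * stepSize τ N ≤ 2 * τ := by push_cast; nlinarith
        rw [← mul_assoc]
        gcongr
    _ = _ := (ENNReal.ofReal_add hB0 (by positivity)).symm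

end MomentBounds

/-! ### Choice of the constants. -/

theorem proposition4p1 {d m : ℕ}
    {Ω : Type*} [MeasurableSpace Ω] (P : Measure Ω) [IsProbabilityMeasure P]
    (W : ℝ≥0 → Ω → EuclideanSpace ℝ (Fin m)) (hW : IsBrownianMotion W P)
    {τ : ℝ} (hτ : 0 < τ)
    (f : EuclideanSpace ℝ (Fin d) → EuclideanSpace ℝ (Fin d) → EuclideanSpace ℝ (Fin d))
    (g : EuclideanSpace ℝ (Fin d) → EuclideanSpace ℝ (Fin d) → Matrix (Fin d) (Fin m) ℝ)
    (hH1 : LocallyLipschitzCoeff f g)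
    (α a₁ a₂ a₃ : ℝ) (hH2 : Dissipative f g α a₁ a₂ a₃)
    (Φ : Set.Ici (1 : ℝ) → ℝ≥0) (hΦ : IsGrowthControl f g Φ)
    (ν : ℝ) (hν : ν ∈ Set.Ioc (0 : ℝ) (1 / 3))
    (Δ₁ : ℝ) (hΔ₁ : Δ₁ ∈ Set.Ioo (0 : ℝ) 1)
    (htr : a₃ < a₂ - 6 * truncConst f g Φ ^ 2 * Δ₁ ^ (1 - 2 * ν)) :
    ∀ M : ℝ, 0 < M → ∀ ε : ℝ, 0 < ε → ∃ Λ : ℝ, M < Λ ∧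
      (⨆ (N : ℕ+) (_ : stepSize τ N ≤ Δ₁) (k : ℕ)
        (ξ : C(Set.Icc (-τ) 0, EuclideanSpace ℝ (Fin d))) (_ : ‖ξ‖ ≤ M),
          P {ω | Λ < ‖temsp f g Φ ν hτ N ξ (fun t => W t ω) k‖}) < ENNReal.ofReal ε := by

  intro M hM ε hε
  set q := 6 * truncConst f g Φ ^ 2 * Δ₁ ^ (1 - 2 * ν) with hq
  have hq0 : 0 ≤ q := mul_nonneg (by positivity) (Real.rpow_nonneg hΔ₁.1.le _)
  set b := a₂ - q with hb
  -- The midpoint leaves both surpluses `b - c` and `c - a₃` positive.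
  set c := (a₃ + b) / 2 with hc
  have ha := hH2.nonneg₃
  have hac : a₃ < c := by linarith
  have hcb : c < b := by linarith
  have hc0 : 0 < c := ha.trans_lt hac
  have hC : 0 ≤ a₁ + 2 * q := by linarith [hH2.nonneg₁]
  set κ := min 1 (min (b - c) ((c - a₃) / (τ * c))) with hκ
  have hκ0 : 0 < κ :=
    lt_min one_pos (lt_min (by linarith) (div_pos (by linarith) (by positivity)))
  set D := max (M ^ 2 + τ * c * M ^ α) ((a₁ + 2 * q + κ) / κ) + 2 * τ * (a₁ + 2 * q + κ)
  have hD : 0 ≤ D :=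
    add_nonneg ((by positivity : (0 : ℝ) ≤ (a₁ + 2 * q + κ) / κ).trans (le_max_right _ _))
      (by positivity)
  -- Chosen so that `D / Λ² ≤ ε / 2`; the half keeps the inequality strict after the suprema.
  set Λ := M + 1 + √(2 * D / ε) with hΛ
  have hsqrt := Real.sqrt_nonneg (2 * D / ε)
  have hMΛ : M < Λ := by linarith
  have hΛ2 : D ≤ Λ ^ 2 * (ε / 2) := by
    have h1 : 2 * D / ε ≤ Λ ^ 2 := by
      rw [← Real.sq_sqrt (by positivity : 0 ≤ 2 * D / ε)]
      gcongr
      linarith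
    rw [div_le_iff₀ hε] at h1
    linarith
  refine ⟨Λ, hMΛ, lt_of_le_of_lt ?_
    ((ENNReal.ofReal_lt_ofReal_iff hε).2 (half_lt_self hε))⟩
  refine iSup_le fun N => iSup_le fun hN => iSup_le fun k => iSup_le fun ξ => iSup_le fun hξ => ?_
  have hpos : 0 < ENNReal.ofReal (Λ ^ 2) := ENNReal.ofReal_pos.2 (pow_pos (hM.trans hMΛ) 2)
  refine (ENNReal.mul_le_mul_iff_right hpos.ne' ENNReal.ofReal_ne_top).1 ?_
  rw [← ENNReal.ofReal_mul (sq_nonneg Λ)]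
  refine (mul_measure_norm_temsp_gt_le hW hH1 hτ N (hN.trans hΔ₁.2.le) hM.le hξ hH2.two_le ha hac
    hC hκ0 (min_le_left _ _) ((min_le_right _ _).trans (min_le_left _ _))
    ((min_le_right _ _).trans (min_le_right _ _)) (fun x y hx hy => ?_) hMΛ.le k).trans
    (ENNReal.ofReal_le_ofReal hΛ2)
  exact hH2.step_le hΦ hν.1.le (by linarith [hν.2]) (stepSize_pos hτ N) hN hΔ₁.2.le hx hy
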